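/- Let $k\in\{1,2,\dots\}\cup\{\infty,\omega\}$. Let $\mathcal M$ and $\Gamma$ be $C^k$ Banach manifolds without boundary, modelled on real Banach spaces $E$ and $F$ respectively; assume that the topology of $\mathcal M$ has a countable base and that $\Gamma$ is separable (for a metrizable $\mathcal M$, having a countable base is the same as being separable; the Hausdorff property is not needed). Let $\pi:\mathcal M\to\Gamma$ be a $C^1$ Fredholm map of index $0$, i.e. a $C^1$ map such that for every $x\in\mathcal M$ the derivative $D\pi(x):T_x\mathcal M\to T_{\pi(x)}\Gamma$ is a Fredholm operator with $\dim\ker D\pi(x)-\dim\operatorname{coker}D\pi(x)=0$. Let $C_{\mathcal M}\subset\mathcal M$ be the set of critical points of $\pi$, i.e. the points $x$ at which $D\pi(x)$ is not surjective. Let $\mathcal S$ be a closed subset of $\mathcal M$ such that $\mathcal S\setminus C_{\mathcal M}$ is nowhere dense in $\mathcal M$. Then $\pi(\mathcal S)$ is a meager subset of $\Gamma$. -/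

import Mathlib

open scoped Manifold ContDiff

section

variable {E F : Type*} [NormedAddCommGroup E] [NormedSpace ℝ E]
  [NormedAddCommGroup F] [NormedSpace ℝ F]
  {M Γ : Type*} [TopologicalSpace M] [ChartedSpace E M]
  [TopologicalSpace Γ] [ChartedSpace F Γ]

variable (E F) in
/-- A `C^1` Fredholm map of index `0` between Banach manifolds modelled on `E` and `F`: a `C^1` map
whose derivative at every point is a Fredholm operator of index
`dim ker - dim coker = 0`. -/
structure IsC1FredholmMapIndexZero (π : M → Γ) : Prop where
  contMDiff : ContMDiff 𝓘(ℝ, E) 𝓘(ℝ, F) 1 π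
  isFredholm : ∀ x : M, (mfderiv 𝓘(ℝ, E) 𝓘(ℝ, F) π x).IsFredholm
  index_eq_zero : ∀ x : M, (mfderiv 𝓘(ℝ, E) 𝓘(ℝ, F) π x).toLinearMap.index = 0

variable (E F) in
/-- The set of critical points of a `C^1` map: the points at which its derivative is not
surjective. -/
def criticalSet (π : M → Γ) : Set M :=
  {x : M | ¬ Function.Surjective (mfderiv 𝓘(ℝ, E) 𝓘(ℝ, F) π x)}

end

open Filter Topology MeasureTheory Set

/-- The image of a nowhere dense set under an open partial homeomorphism is nowhere dense. -/
theorem OpenPartialHomeomorph.isNowhereDense_image {X Y : Type*} [TopologicalSpace X]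
    [TopologicalSpace Y] (φ : OpenPartialHomeomorph X Y) {s : Set X} (hs : IsNowhereDense s) :
    IsNowhereDense (φ '' (s ∩ φ.source)) := by
  rw [isNowhereDense_iff_forall_notMem_nhds] at hs ⊢
  rintro _ ⟨x, ⟨hxs, hx⟩, rfl⟩ hcl
  refine hs x hxs ?_
  filter_upwards [φ.continuousAt hx hcl, φ.open_source.mem_nhds hx] with x' h1 h2
  rw [← φ.left_inv h2]
  refine closure_mono ?_ (mem_closure_image
    (φ.continuousAt_symm (φ.map_source h2)) h1)
  rintro _ ⟨_, ⟨z, ⟨hz, hz'⟩, rfl⟩, rfl⟩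
  rwa [φ.left_inv hz']

section

variable {E F : Type*} [NormedAddCommGroup E] [NormedSpace ℝ E]
  [NormedAddCommGroup F] [NormedSpace ℝ F]

/-- A Fredholm operator of index zero becomes invertible after adding a suitable operator of
finite rank. -/
theorem ContinuousLinearMap.IsFredholm.exists_finiteRank_add_eq_equiv [CompleteSpace E]
    [CompleteSpace F] {L : E →L[ℝ] F} (hL : L.IsFredholm) (h0 : L.toLinearMap.index = 0) :
    ∃ (V : Submodule ℝ F) (T : E →L[ℝ] V) (A : E ≃L[ℝ] F), FiniteDimensional ℝ V ∧
      (A : E →L[ℝ] F) = L + V.subtypeL ∘L T := by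
  have hk : FiniteDimensional ℝ L.ker := hL.finite_ker
  have hc : FiniteDimensional ℝ (F ⧸ L.range) := hL.finite_coker
  obtain ⟨p, hp⟩ := hL.closedComplemented_ker
  have hdim : Module.finrank ℝ L.ker = Module.finrank ℝ (F ⧸ L.range) := by
    simp only [LinearMap.index] at h0
    exact_mod_cast sub_eq_zero.mp h0
  let φ : L.ker ≃ₗ[ℝ] (F ⧸ L.range) := LinearEquiv.ofFinrankEq _ _ hdim
  obtain ⟨s, hs⟩ := L.range.mkQ.exists_rightInverse_of_surjective L.range.range_mkQ
  have hs' : ∀ q, L.range.mkQ (s q) = q := fun q => LinearMap.congr_fun hs q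
  let T : E →L[ℝ] LinearMap.range s :=
    (s.rangeRestrict ∘ₗ φ.toLinearMap).toContinuousLinearMap ∘L p
  have hLQ : ∀ x, L.range.mkQ (L x) = 0 := fun x => by simp
  let B : E →L[ℝ] F := L + (LinearMap.range s).subtypeL ∘L T
  have hB : ∀ x, B x = L x + s (φ (p x)) := fun x => rfl
  have hker : B.ker = ⊥ := by
    rw [LinearMap.ker_eq_bot']
    intro x hx
    have hx : L x + s (φ (p x)) = 0 := hx
    have h1 : φ (p x) = 0 := by
      have := congrArg L.range.mkQ hx
      rwa [map_add, hLQ, hs', zero_add, map_zero] at this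
    have h2 : L x = 0 := by rwa [h1, map_zero, add_zero] at hx
    have h3 : p x = 0 := by simpa using h1
    have := hp ⟨x, h2⟩
    rw [h3] at this
    exact (congrArg Subtype.val this).symm
  have hrange : B.range = ⊤ := by
    rw [LinearMap.range_eq_top]
    intro y
    set k := φ.symm (L.range.mkQ y) with hk
    have hy : y - s (φ k) ∈ L.range := by
      have h1 : L.range.mkQ (y - s (φ k)) = 0 := by
        rw [map_sub, hs', hk, LinearEquiv.apply_symm_apply, sub_self]
      simpa only [Submodule.mkQ_apply, Submodule.Quotient.mk_eq_zero] using h1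
    obtain ⟨x, hx⟩ := hy
    refine ⟨x - p x + k, ?_⟩
    have h1 : ∀ z : L.ker, L z = 0 := fun z => z.2
    have h2 : p (x - p x + k) = k := by simp [hp]
    have hx : L x = y - s (φ k) := hx
    change B _ = y
    rw [hB, h2, map_add, map_sub, h1, h1, hx]
    abel
  exact ⟨LinearMap.range s, T, ContinuousLinearEquiv.ofBijective B hker hrange, inferInstance,
    by ext x; rfl⟩

/-- **Sard's theorem** for perturbations of the identity by a map into a finite-dimensional
subspace. -/
theorem isNowhereDense_image_sub_of_det_eq_zero {V : Submodule ℝ F} [FiniteDimensional ℝ V]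
    {u : F → V} {Z : Set F} {C : ℝ} (hZ : IsClosed Z) (hu : ∀ y ∈ Z, DifferentiableAt ℝ u y)
    (hC : ∀ y ∈ Z, ‖u y‖ ≤ C)
    (hdet : ∀ y ∈ Z, (ContinuousLinearMap.id ℝ V - fderiv ℝ u y ∘L V.subtypeL).det = 0) :
    IsNowhereDense ((fun y => y - (u y : F)) '' Z) := by
  have hclosed : IsClosed ((fun y => y - (u y : F)) '' Z) := by
    refine IsSeqClosed.isClosed fun x z hx hxz => ?_
    choose y hyZ hy using hx
    obtain ⟨v, -, σ, hσ, hv⟩ := (isCompact_closedBall (0 : V) C).tendsto_subseq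
      (x := fun n => u (y n)) (fun n => by simpa using hC _ (hyZ n))
    have hv' : Tendsto (fun n => (u (y (σ n)) : F)) atTop (𝓝 v) :=
      (continuous_subtype_val.tendsto v).comp hv
    have hyσ : Tendsto (fun n => y (σ n)) atTop (𝓝 (z + v)) := by
      refine ((hxz.comp hσ.tendsto_atTop).add hv').congr fun n => ?_
      simp [← hy]
    have hmem : z + v ∈ Z := hZ.mem_of_tendsto hyσ (Eventually.of_forall fun n => hyZ _)
    refine ⟨z + v, hmem, ?_⟩
    have h1 : u (z + v) = v :=
      tendsto_nhds_unique ((hu _ hmem).continuousAt.tendsto.comp hyσ) hv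
    simp [h1]
  rw [hclosed.isNowhereDense_iff, eq_empty_iff_forall_notMem]
  intro c hc
  borelize ↥V
  let μ : Measure V := Measure.addHaar
  let g : V → V := fun w => w - u (c + w)
  let s : Set V := {w | c + (w : F) ∈ Z}
  have hg : ∀ w ∈ s, HasFDerivWithinAt g
      (ContinuousLinearMap.id ℝ V - fderiv ℝ u (c + w) ∘L V.subtypeL) s w := by
    intro w hw
    have h1 : HasFDerivAt (fun w : V => c + (w : F)) V.subtypeL w :=
      V.subtypeL.hasFDerivAt.const_add c
    exact ((hasFDerivAt_id w).sub
      ((hu _ hw).hasFDerivAt.comp w h1)).hasFDerivWithinAt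
  have hnull : μ (g '' s) = 0 :=
    addHaar_image_eq_zero_of_det_fderivWithin_eq_zero μ hg fun w hw => hdet _ hw
  have hcont : Continuous fun w : V => c + (w : F) := by fun_prop
  have hO : IsOpen ((fun w : V => c + (w : F)) ⁻¹' interior ((fun y => y - (u y : F)) '' Z)) :=
    isOpen_interior.preimage hcont
  refine (hO.measure_pos μ ⟨0, by simpa using hc⟩).ne' (measure_mono_null ?_ hnull)
  intro v hv
  obtain ⟨y, hyZ, hy⟩ := interior_subset hv
  have hy' : y = c + ((v + u y : V) : F) := by
    have : y = c + v + u y := sub_eq_iff_eq_add.mp hy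
    rw [Submodule.coe_add, ← add_assoc, ← this]
  refine ⟨v + u y, by simpa only [s, mem_ofPred_eq, ← hy'] using hyZ, ?_⟩
  simp only [g, ← hy', add_sub_cancel_right]

/-- If `u` takes values in a subspace `V` and `1 - u` is invertible on `V`, then `1 - u` is
surjective. -/
theorem ContinuousLinearMap.surjective_id_sub_of_det_ne_zero {V : Submodule ℝ F}
    [FiniteDimensional ℝ V] {u : F →L[ℝ] V}
    (h : (ContinuousLinearMap.id ℝ V - u ∘L V.subtypeL).det ≠ 0) :
    Function.Surjective (ContinuousLinearMap.id ℝ F - V.subtypeL ∘L u) := by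
  intro z
  have hs : Function.Surjective (ContinuousLinearMap.id ℝ V - u ∘L V.subtypeL) :=
    ((ContinuousLinearMap.id ℝ V - u ∘L V.subtypeL).toContinuousLinearEquivOfDetNeZero h).surjective
  obtain ⟨w, hw⟩ := hs (u z)
  refine ⟨z + w, ?_⟩
  have : (w : F) - u w = u z := by
    simpa using congrArg Subtype.val hw
  simp only [sub_apply, id_apply, comp_apply, map_add, Submodule.subtypeL_apply,
    ← this]
  abel

/-- The **Sard–Smale theorem** in index zero, locally: near a point where the derivative of a `C^1`
map is Fredholm of index zero, the set of critical values is nowhere dense. -/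
theorem ContDiffAt.exists_isNowhereDense_image_critical [CompleteSpace E] [CompleteSpace F]
    {f : E → F} {a : E} (hf : ContDiffAt ℝ 1 f a) (hL : (fderiv ℝ f a).IsFredholm)
    (h0 : (fderiv ℝ f a).toLinearMap.index = 0) :
    ∃ U ∈ 𝓝 a, IsNowhereDense (f '' (U ∩ {x | ¬ Function.Surjective (fderiv ℝ f x)})) := by
  obtain ⟨V, T, A, hV, hA⟩ := hL.exists_finiteRank_add_eq_equiv h0
  let h : E → F := fun x => f x + T x
  have hh : ContDiffAt ℝ 1 h a := hf.add (V.subtypeL ∘L T).contDiff.contDiffAt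
  have hh' : HasFDerivAt h (A : E →L[ℝ] F) a := by
    rw [hA]
    exact (hf.differentiableAt one_ne_zero).hasFDerivAt.add (V.subtypeL ∘L T).hasFDerivAt
  let Φ := hh.toOpenPartialHomeomorph h hh' one_ne_zero
  have ha : a ∈ Φ.source := hh.mem_toOpenPartialHomeomorph_source hh' one_ne_zero
  have hsymm : ContDiffAt ℝ 1 Φ.symm (Φ a) := hh.to_localInverse hh' one_ne_zero
  let u : F → V := fun y => T (Φ.symm y)
  have hu : ContDiffAt ℝ 1 u (Φ a) := T.contDiff.contDiffAt.comp _ hsymm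
  have hfs : ∀ᶠ y in 𝓝 (Φ a), DifferentiableAt ℝ f (Φ.symm y) := by
    have h1 := (hf.eventually (by simp)).mono fun x hx => hx.differentiableAt one_ne_zero
    refine hsymm.continuousAt.tendsto.eventually ?_
    rwa [Φ.left_inv ha]
  have hbd : ∀ᶠ y in 𝓝 (Φ a), ‖u y‖ ≤ ‖u (Φ a)‖ + 1 :=
    (hu.continuousAt.norm.eventually_lt_const (lt_add_one _)).mono fun _ => le_of_lt
  have hev := (hu.eventually (by simp)).and <| (hsymm.eventually (by simp)).and <| hfs.and <|
    hbd.and (Φ.open_target.mem_nhds (Φ.map_source ha))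
  obtain ⟨r, hr, hball⟩ := Metric.nhds_basis_closedBall.eventually_iff.mp hev
  let d : F → ℝ := fun y => (ContinuousLinearMap.id ℝ V - fderiv ℝ u y ∘L V.subtypeL).det
  have hd : ContinuousOn d (Metric.closedBall (Φ a) r) := by
    intro y hy
    refine ContinuousAt.continuousWithinAt ?_
    have h1 : ContinuousAt (fderiv ℝ u) y :=
      ((hball hy).1.fderiv_right (m := 0) (by simp)).continuousAt
    refine ContinuousLinearMap.continuous_det.continuousAt.comp ?_
    exact continuousAt_const.sub (h1.clm_comp continuousAt_const)
  have hZ : IsClosed (Metric.closedBall (Φ a) r ∩ d ⁻¹' {0}) :=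
    hd.preimage_isClosed_of_isClosed Metric.isClosed_closedBall isClosed_singleton
  refine ⟨Φ.source ∩ Φ ⁻¹' Metric.closedBall (Φ a) r, inter_mem (Φ.open_source.mem_nhds ha)
    (Φ.continuousAt ha (Metric.closedBall_mem_nhds _ hr)), ?_⟩
  refine (isNowhereDense_image_sub_of_det_eq_zero (u := u) hZ
    (fun y hy => (hball hy.1).1.differentiableAt one_ne_zero)
    (fun y hy => (hball hy.1).2.2.2.1) (fun y hy => hy.2)).mono ?_
  rintro _ ⟨x, ⟨⟨hxs, hxb⟩, hx⟩, rfl⟩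
  obtain ⟨hu1, hs1, hf1, -, ht1⟩ := hball hxb
  refine ⟨Φ x, ⟨hxb, ?_⟩, ?_⟩
  · by_contra hne
    have hsurj := ContinuousLinearMap.surjective_id_sub_of_det_ne_zero hne
    have e1 : HasFDerivAt (fun y => y - (u y : F))
        (ContinuousLinearMap.id ℝ F - V.subtypeL ∘L fderiv ℝ u (Φ x)) (Φ x) :=
      (hasFDerivAt_id _).sub
        (V.subtypeL.hasFDerivAt.comp _ (hu1.differentiableAt one_ne_zero).hasFDerivAt)
    have e2 := hf1.hasFDerivAt.comp (Φ x) (hs1.differentiableAt one_ne_zero).hasFDerivAt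
    have e3 : (fun y => y - (u y : F)) =ᶠ[𝓝 (Φ x)] f ∘ Φ.symm := by
      filter_upwards [Φ.open_target.mem_nhds ht1] with y hy
      have h2 : h (Φ.symm y) = y := Φ.right_inv hy
      simp only [Function.comp, u]
      rw [sub_eq_iff_eq_add]
      exact h2.symm
    have e4 := e1.unique (e2.congr_of_eventuallyEq e3)
    rw [e4, Φ.left_inv hxs] at hsurj
    exact hx (Function.Surjective.of_comp (g := fderiv ℝ Φ.symm (Φ x)) hsurj)
  · change Φ x - (T (Φ.symm (Φ x)) : F) = f x
    rw [Φ.left_inv hxs]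
    exact add_sub_cancel_right _ _

/-- Near a point where its derivative is surjective and Fredholm of index zero, a `C^1` map sends
nowhere dense sets to nowhere dense sets. -/
theorem ContDiffAt.exists_isNowhereDense_image_of_surjective [CompleteSpace E] [CompleteSpace F]
    {f : E → F} {a : E} (hf : ContDiffAt ℝ 1 f a) (hL : (fderiv ℝ f a).IsFredholm)
    (h0 : (fderiv ℝ f a).toLinearMap.index = 0) (hs : Function.Surjective (fderiv ℝ f a)) :
    ∃ U ∈ 𝓝 a, ∀ s, IsNowhereDense s → IsNowhereDense (f '' (s ∩ U)) := by
  have hk : FiniteDimensional ℝ (fderiv ℝ f a).ker := hL.finite_ker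
  have hrange : (fderiv ℝ f a).range = ⊤ := LinearMap.range_eq_top.mpr hs
  have hker : (fderiv ℝ f a).ker = ⊥ := by
    have : Subsingleton (F ⧸ (fderiv ℝ f a).range) :=
      Submodule.Quotient.subsingleton_iff.mpr hrange
    rw [LinearMap.index, Module.finrank_zero_of_subsingleton (M := F ⧸ (fderiv ℝ f a).range)] at h0
    exact Submodule.finrank_eq_zero.mp (by simpa using h0)
  have hf' : HasFDerivAt f (ContinuousLinearEquiv.ofBijective _ hker hrange : E →L[ℝ] F) a := by
    rw [ContinuousLinearEquiv.coe_ofBijective]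
    exact (hf.differentiableAt one_ne_zero).hasFDerivAt
  let Φ := hf.toOpenPartialHomeomorph f hf' one_ne_zero
  exact ⟨Φ.source, Φ.open_source.mem_nhds (hf.mem_toOpenPartialHomeomorph_source hf' one_ne_zero),
    fun s hs => Φ.isNowhereDense_image hs⟩

end

section

variable {E F : Type*} [NormedAddCommGroup E] [NormedSpace ℝ E]
  [NormedAddCommGroup F] [NormedSpace ℝ F]
  {M Γ : Type*} [TopologicalSpace M] [ChartedSpace E M]
  [TopologicalSpace Γ] [ChartedSpace F Γ]

/-- If a map read in charts has surjective derivative, so does the map. -/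
theorem surjective_mfderiv_of_surjective_fderiv_writtenInExtChartAt [IsManifold 𝓘(ℝ, E) 1 M]
    [IsManifold 𝓘(ℝ, F) 1 Γ] {π : M → Γ} {x₀ x : M} (hx : x ∈ (extChartAt 𝓘(ℝ, E) x₀).source)
    (hπx : π x ∈ (extChartAt 𝓘(ℝ, F) (π x₀)).source)
    (hπ : ContinuousAt π x)
    (hd : DifferentiableAt ℝ (writtenInExtChartAt 𝓘(ℝ, E) 𝓘(ℝ, F) x₀ π)
      (extChartAt 𝓘(ℝ, E) x₀ x))
    (hs : Function.Surjective (fderiv ℝ (writtenInExtChartAt 𝓘(ℝ, E) 𝓘(ℝ, F) x₀ π)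
      (extChartAt 𝓘(ℝ, E) x₀ x))) :
    Function.Surjective (mfderiv 𝓘(ℝ, E) 𝓘(ℝ, F) π x) := by
  set f := writtenInExtChartAt 𝓘(ℝ, E) 𝓘(ℝ, F) x₀ π with hf
  set e := extChartAt 𝓘(ℝ, E) x₀ with he
  set e' := extChartAt 𝓘(ℝ, F) (π x₀) with he'
  have hfx : f (e x) = e' (π x) := by
    simp only [hf, writtenInExtChartAt, Function.comp, ← he, ← he', e.left_inv hx]
  have h1 : HasMFDerivAt 𝓘(ℝ, E) 𝓘(ℝ, E) e x (mfderiv 𝓘(ℝ, E) 𝓘(ℝ, E) e x) :=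
    (mdifferentiableAt_extChartAt (by simpa [he] using hx)).hasMFDerivAt
  have h2 : HasMFDerivAt 𝓘(ℝ, E) 𝓘(ℝ, F) f (e x) (fderiv ℝ f (e x)) :=
    hd.hasFDerivAt.hasMFDerivAt
  have h3 : HasMFDerivAt 𝓘(ℝ, F) 𝓘(ℝ, F) e'.symm (f (e x))
      (mfderiv 𝓘(ℝ, F) 𝓘(ℝ, F) e'.symm (f (e x))) := by
    have := mdifferentiableWithinAt_extChartAt_symm (I := 𝓘(ℝ, F)) (x := π x₀)
      (z := f (e x)) (by rw [hfx]; exact e'.map_source hπx)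
    rw [modelWithCornersSelf_coe, range_id, mdifferentiableWithinAt_univ] at this
    exact this.hasMFDerivAt
  have h4 := h3.comp x (h2.comp x h1)
  have h5 : π =ᶠ[𝓝 x] e'.symm ∘ f ∘ e := by
    filter_upwards [hπ (extChartAt_source_mem_nhds' hπx), extChartAt_source_mem_nhds' hx]
      with z hz1 hz2
    have hz2 : z ∈ e.source := hz2
    simp only [hf, writtenInExtChartAt, Function.comp, ← he, ← he', e.left_inv hz2]
    exact (e'.left_inv hz1).symm
  have h6 := h4.congr_of_eventuallyEq h5
  rw [h6.mfderiv]
  have i1 : (mfderiv 𝓘(ℝ, E) 𝓘(ℝ, E) e x).IsInvertible := isInvertible_mfderiv_extChartAt hx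
  have i3 : (mfderiv 𝓘(ℝ, F) 𝓘(ℝ, F) e'.symm (f (e x))).IsInvertible := by
    have := isInvertible_mfderivWithin_extChartAt_symm (I := 𝓘(ℝ, F)) (x := π x₀)
      (y := f (e x)) (by rw [hfx]; exact e'.map_source hπx)
    rwa [modelWithCornersSelf_coe, range_id, mfderivWithin_univ] at this
  exact i3.bijective.surjective.comp (hs.comp i1.bijective.surjective)

variable [CompleteSpace E] [CompleteSpace F]

/-- Locally, a `C^1` Fredholm map of index zero sends its critical points, and every nowhere dense
set of regular points, to a meagre set. -/
theorem IsC1FredholmMapIndexZero.exists_isMeagre_image [IsManifold 𝓘(ℝ, E) 1 M]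
    [IsManifold 𝓘(ℝ, F) 1 Γ] {π : M → Γ} (hπ : IsC1FredholmMapIndexZero E F π) (x₀ : M) :
    ∃ U ∈ 𝓝 x₀, IsMeagre (π '' (U ∩ criticalSet E F π)) ∧
      (x₀ ∉ criticalSet E F π → ∀ s, IsNowhereDense s → IsMeagre (π '' (U ∩ s))) := by
  set f := writtenInExtChartAt 𝓘(ℝ, E) 𝓘(ℝ, F) x₀ π with hf
  set e := chartAt E x₀ with he
  set e' := chartAt F (π x₀) with he'
  have hfe : ∀ x ∈ e.source, f (e x) = e' (π x) := by
    intro x hx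
    simp [hf, writtenInExtChartAt, Function.comp, ← he, ← he', e.left_inv hx]
  have hc : ContDiffAt ℝ 1 f (e x₀) := by
    have := (contMDiffAt_iff.mp (hπ.contMDiff x₀)).2
    rw [modelWithCornersSelf_coe, range_id, contDiffWithinAt_univ] at this
    simpa [hf, he, writtenInExtChartAt] using this
  have hD : mfderiv 𝓘(ℝ, E) 𝓘(ℝ, F) π x₀ = fderiv ℝ f (e x₀) := by
    rw [((hπ.contMDiff x₀).mdifferentiableAt one_ne_zero).mfderiv]
    simp [hf, he]
    rfl
  have hL : (fderiv ℝ f (e x₀)).IsFredholm := hD ▸ hπ.isFredholm x₀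
  have h0 : (fderiv ℝ f (e x₀)).toLinearMap.index = 0 := hD ▸ hπ.index_eq_zero x₀
  have hx₀ : x₀ ∈ e.source := mem_chart_source E x₀
  have hcont : Continuous π := hπ.contMDiff.continuous
  let W : Set M := e.source ∩ π ⁻¹' e'.source
  have hW : W ∈ 𝓝 x₀ := inter_mem (e.open_source.mem_nhds hx₀)
    (hcont.continuousAt (e'.open_source.mem_nhds (mem_chart_source F _)))
  have hdiff : ∀ᶠ x in 𝓝 x₀, DifferentiableAt ℝ f (e x) :=
    (e.continuousAt hx₀).eventually
      ((hc.eventually (by simp)).mono fun y hy => hy.differentiableAt one_ne_zero)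
  have key : ∀ (A : Set M) (B : Set E), A ⊆ W → (∀ x ∈ A, e x ∈ B) → IsNowhereDense (f '' B) →
      IsMeagre (π '' A) := by
    intro A B hA hB hn
    refine ((e'.symm.isNowhereDense_image hn).mono ?_).isMeagre
    rintro _ ⟨x, hx, rfl⟩
    have hx1 := hfe x (hA hx).1
    refine ⟨e' (π x), ⟨⟨e x, hB x hx, hx1⟩, e'.map_source (hA hx).2⟩, e'.left_inv (hA hx).2⟩
  have pull : ∀ U ∈ 𝓝 (e x₀), e ⁻¹' U ∈ 𝓝 x₀ := fun U hU => e.continuousAt hx₀ hU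
  obtain ⟨U, hU, hUn⟩ := hc.exists_isNowhereDense_image_critical hL h0
  have hcrit : ∀ N ⊆ W ∩ {x | DifferentiableAt ℝ f (e x)} ∩ e ⁻¹' U,
      IsMeagre (π '' (N ∩ criticalSet E F π)) := by
    intro N hN
    refine key _ (U ∩ {y | ¬ Function.Surjective (fderiv ℝ f y)})
      (fun x hx => (hN hx.1).1.1) (fun x hx => ⟨(hN hx.1).2, fun hs => hx.2 ?_⟩) hUn
    have hW := (hN hx.1).1
    exact surjective_mfderiv_of_surjective_fderiv_writtenInExtChartAt (x₀ := x₀)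
      (by simpa using hW.1.1) (by simpa using hW.1.2) hcont.continuousAt
      hW.2 hs
  have hN0 := inter_mem (inter_mem hW hdiff) (pull U hU)
  by_cases hreg : x₀ ∈ criticalSet E F π
  · exact ⟨_, hN0, hcrit _ subset_rfl, fun h => absurd hreg h⟩
  · obtain ⟨U', hU', hU'n⟩ := hc.exists_isNowhereDense_image_of_surjective hL h0
      (hD ▸ not_not.mp hreg)
    refine ⟨_, inter_mem hN0 (pull U' hU'), hcrit _ inter_subset_left, fun _ s hs => ?_⟩
    exact key _ (e '' (s ∩ e.source) ∩ U') (fun x hx => hx.1.1.1.1)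
      (fun x hx => ⟨⟨x, ⟨hx.2, hx.1.1.1.1.1⟩, rfl⟩, hx.1.2⟩)
      (hU'n _ (e.isNowhereDense_image hs))

end

theorem mainTheorem4
    {E : Type*} [NormedAddCommGroup E] [NormedSpace ℝ E] [CompleteSpace E]
    {F : Type*} [NormedAddCommGroup F] [NormedSpace ℝ F] [CompleteSpace F]
    {M : Type*} [TopologicalSpace M] [SecondCountableTopology M] [ChartedSpace E M]
    {Γ : Type*} [TopologicalSpace Γ] [TopologicalSpace.SeparableSpace Γ] [ChartedSpace F Γ]
    (k : WithTop ℕ∞) (hk : 1 ≤ k)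
    [IsManifold 𝓘(ℝ, E) k M] [IsManifold 𝓘(ℝ, F) k Γ]
    (π : M → Γ) (hπ : IsC1FredholmMapIndexZero E F π)
    (S : Set M) (hS : IsClosed S)
    (hnd : IsNowhereDense (S \ criticalSet E F π)) :
    IsMeagre (π '' S) := by
  have : IsManifold 𝓘(ℝ, E) 1 M := IsManifold.of_le hk
  have : IsManifold 𝓘(ℝ, F) 1 Γ := IsManifold.of_le hk
  choose U hU hcrit hreg using hπ.exists_isMeagre_image
  obtain ⟨t, ht, htU⟩ := TopologicalSpace.countable_cover_nhds hU
  obtain ⟨t', ht'S, ht', htU'⟩ := TopologicalSpace.countable_cover_nhdsWithin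
    (s := (criticalSet E F π)ᶜ) fun x _ => mem_nhdsWithin_of_mem_nhds (hU x)
  have : Countable t := ht
  have : Countable t' := ht'
  refine ((isMeagre_iUnion fun x : t => hcrit x).union
    (isMeagre_iUnion fun x : t' => hreg x (ht'S x.2) _ hnd)).mono ?_
  rintro _ ⟨x, hx, rfl⟩
  by_cases hxc : x ∈ criticalSet E F π
  · obtain ⟨y, hy, hxy⟩ := mem_iUnion₂.mp (htU.symm ▸ mem_univ x)
    exact Or.inl (mem_iUnion.mpr ⟨⟨y, hy⟩, x, ⟨hxy, hxc⟩, rfl⟩)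
  · obtain ⟨y, hy, hxy⟩ := mem_iUnion₂.mp (htU' hxc)
    exact Or.inr (mem_iUnion.mpr ⟨⟨y, hy⟩, x, ⟨hxy, hx, hxc⟩, rfl⟩)
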